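/- Let $\Sigma=\{S_0,S_1\}\cup\Sigma'$ be a signature with fixed arities, in which $S_0,S_1$ are unary, and let $\mathcal V$ be a set of variables. Terms are built from variables, the constant $0$ and the symbols of $\Sigma$. Sequences are finite sequences of terms; a term $t$ is identified with the one-element sequence $(t)$, and $0$ with the empty sequence $()$, so that $()$, $0$ and $(0)$ are the same sequence, while a longer sequence keeps its components $0$. Write $a * b$ for concatenation (in which $0$ may be read as $()$ or as $(0)$). Let $\lesssim$ be a quasi-order on $\Sigma$ (the precedence) with well-founded strict part $<$ and equivalence $\sim$, such that $S_0\sim S_1$ and $S_0,S_1<f$ for all $f\in\Sigma'$. The relation $\sqsubset$ on terms is defined inductively (with reflexive closure $\sqsubseteq$): 1. $s\sqsubset f(t_1,\dots,t_n)$ if $s\sqsubseteq t_j$ for some $j$; 2. $g(s_1,\dots,s_m)\sqsubset t=f(t_1,\dots,t_n)$ if $g<f$ and $s_i\sqsubset t$ for all $i$. The path order for FP, $<_{\mathrm{pop}}$, is the relation on sequences defined inductively (with reflexive closure $\le_{\mathrm{pop}}$), where $s,s_i,t,t_j$ are terms and $f,g\in\Sigma$, by: 1. $s<_{\mathrm{pop}}t$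 if $s\sqsubset t$; 2. if $s\le_{\mathrm{pop}}t_j$ for some $j\in\{1,\dots,n\}$, then $s<_{\mathrm{pop}}f(t_1,\dots,t_n)$ and, if $n\ge 2$, also $s<_{\mathrm{pop}}(t_1,\dots,t_n)$; 3. $(s_1,\dots,s_m)<_{\mathrm{pop}}t=f(t_1,\dots,t_n)$ if $m=0$, or if there is $i_0$ with $s_{i_0}<_{\mathrm{pop}}t$ and $s_i\sqsubset t$ for all $i\ne i_0$; 4. $g(s_1,\dots,s_m)<_{\mathrm{pop}}f(t_1,\dots,t_n)$ if $f\sim g$ and $(s_1,\dots,s_m)<_{\mathrm{pop}}(t_1,\dots,t_n)$; 5. $a<_{\mathrm{pop}}(b_1,\dots,b_n)$ for terms $b_1,\dots,b_n$, $n\ge2$, if the sequence $a$ is a permutation of some concatenation $a_1*\cdots*a_n$ of sequences with $a_i\le_{\mathrm{pop}}b_i$ for all $i$ and $a_i<_{\mathrm{pop}}b_i$ for at least one $i$. For $m\in\mathbb N$ let the numeral $\overline m$ be the ground term with $\overline 0=0$ and $\overline{2m+i}=S_i(\overline m)$ for $i\in\{0,1\}$, $2m+i>0$, and let $|m|$ be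 the binary length of $m$, with $|0|=0$. **Theorem.** Let $\mathcal R$ be a finite set of rewrite rules $l\to r$ between terms, such that $r<_{\mathrm{pop}}l$ for every rule $l\to r$ in $\mathcal R$. Then for every $f\in\Sigma$, of arity $n$, there is a monotone polynomial $p$ such that for all $m_1,\dots,m_n\in\mathbb N$ the derivation length $$\max\{\ell \mid \text{there are ground terms } t_0,\dots,t_\ell \text{ with } f(\overline m_1,\dots,\overline m_n)=t_0\to_{\mathcal R}t_1\to_{\mathcal R}\cdots\to_{\mathcal R}t_\ell\}$$ exists and is at most $p\left(|m_1|+\dots+|m_n|\right)$. -/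

import Mathlib

namespace POP

/-- The signature `Σ = {S₀, S₁} ∪ Σ'`: two symbols `succ false = S₀` and `succ true = S₁`, and the
symbols `fn f` of `Σ'`. -/
inductive Sym (F : Type*) : Type _
  | succ (i : Bool) : Sym F
  | fn (f : F) : Sym F

/-- The arity of a symbol; `S₀` and `S₁` are unary. -/
def Sym.arity {F : Type*} (ar : F → ℕ) : Sym F → ℕ
  | .succ _ => 1
  | .fn f => ar f

/-- Terms over the signature and the variables `V`. The constant `zero` is the empty sequence `()`
used as a term, that is `0 := ()`. -/
inductive Term {F : Type*} (ar : F → ℕ) (V : Type*) : Type _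
  | var (x : V) : Term ar V
  | zero : Term ar V
  | app (f : Sym F) (ts : Fin (f.arity ar) → Term ar V) : Term ar V

variable {F : Type*} {ar : F → ℕ} {V : Type*}

/-- Application of a substitution to a term. -/
def Term.subst (θ : V → Term ar V) : Term ar V → Term ar V
  | .var x => θ x
  | .zero => .zero
  | .app f ts => .app f (fun i => (ts i).subst θ)

/-- A ground term contains no variable. -/
def Term.IsGround : Term ar V → Prop
  | .var _ => False
  | .zero => True
  | .app _ ts => ∀ i, (ts i).IsGround

/-- The numeral of `m`: the numeral of `0` is `()`, the numeral of `2 m + i` (when this number is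
not zero) is `Sᵢ` applied to the numeral of `m`. -/
def numeral (ar : F → ℕ) (V : Type*) (m : ℕ) : Term ar V :=
  Nat.binaryRec Term.zero (fun i _ t => Term.app (Sym.succ i) (fun _ => t)) m

/-- Finite sequences of terms are lists. A term `t` is the sequence `[t]`, and the term `0` is the
empty sequence, so `[]` and `[zero]` denote the same sequence. `SameSeq a b` says that the lists
`a` and `b` denote the same sequence. -/
def SameSeq (a b : List (Term ar V)) : Prop :=
  a = b ∨ ((a = [] ∨ a = [Term.zero]) ∧ (b = [] ∨ b = [Term.zero]))

/-- The auxiliary order `s ⊏ t` on terms induced by the precedence. The first two constructors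
are the two cases `s = t_j` and `s ⊏ t_j` of the clause `s ⊑ t_j → s ⊏ f(t_1, …, t_n)`. -/
inductive SqLt [Preorder (Sym F)] : Term ar V → Term ar V → Prop
  | arg (f : Sym F) (ts : Fin (f.arity ar) → Term ar V) (j : Fin (f.arity ar)) :
      SqLt (ts j) (Term.app f ts)
  | sub (f : Sym F) (ts : Fin (f.arity ar) → Term ar V) (j : Fin (f.arity ar))
      (s : Term ar V) : SqLt s (ts j) → SqLt s (Term.app f ts)
  | app (f g : Sym F) (ts : Fin (f.arity ar) → Term ar V) (ss : Fin (g.arity ar) → Term ar V) :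
      g < f → (∀ i, SqLt (ss i) (Term.app f ts)) → SqLt (Term.app g ss) (Term.app f ts)

/-- The path order `a < b` (path order for FP) on sequences of terms, induced by the precedence. -/
inductive PopLt [Preorder (Sym F)] : List (Term ar V) → List (Term ar V) → Prop
  /-- `s ⊏ t → s < t`. -/
  | sq (s t : Term ar V) : SqLt s t → PopLt [s] [t]
  /-- `s ≤ t_j → s < f(t_1, …, t_n)`, the case of equality. -/
  | arg (f : Sym F) (ts : Fin (f.arity ar) → Term ar V) (j : Fin (f.arity ar)) :
      PopLt [ts j] [Term.app f ts]
  /-- `s ≤ t_j → s < f(t_1, …, t_n)`, the strict case. -/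
  | sub (f : Sym F) (ts : Fin (f.arity ar) → Term ar V) (j : Fin (f.arity ar))
      (s : Term ar V) : PopLt [s] [ts j] → PopLt [s] [Term.app f ts]
  /-- `s ≤ t_j → s < (t_1, …, t_n)` for `n ≥ 2`, the case of equality. -/
  | seqArg (b : List (Term ar V)) (t : Term ar V) :
      2 ≤ b.length → t ∈ b → PopLt [t] b
  /-- `s ≤ t_j → s < (t_1, …, t_n)` for `n ≥ 2`, the strict case. -/
  | seqSub (b : List (Term ar V)) (s t : Term ar V) :
      2 ≤ b.length → t ∈ b → PopLt [s] [t] → PopLt [s] b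
  /-- `() < f(t_1, …, t_n)`. -/
  | nil (f : Sym F) (ts : Fin (f.arity ar) → Term ar V) : PopLt [] [Term.app f ts]
  /-- `(s_1, …, s_m) < t = f(t_1, …, t_n)` if `s_{i₀} < t` for some `i₀`, and `s_i ⊏ t` for all
  `i ≠ i₀`. -/
  | seq (f : Sym F) (ts : Fin (f.arity ar) → Term ar V) (a : List (Term ar V))
      (i₀ : Fin a.length) :
      (∀ i, i ≠ i₀ → SqLt (a.get i) (Term.app f ts)) → PopLt [a.get i₀] [Term.app f ts] →
      PopLt a [Term.app f ts]
  /-- If `f ∼ g`, then `(s_1, …, s_m) < (t_1, …, t_n) → g(s_1, …, s_m) < f(t_1, …, t_n)`. -/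
  | mono (f g : Sym F) (ts : Fin (f.arity ar) → Term ar V) (ss : Fin (g.arity ar) → Term ar V) :
      f ≤ g → g ≤ f → PopLt (List.ofFn ss) (List.ofFn ts) →
      PopLt [Term.app g ss] [Term.app f ts]
  /-- `a < b = (b_1, …, b_n)`, `n ≥ 2`, if `a` is a permutation of a concatenation of sequences
  `a_1, …, a_n` with `a_i ≤ b_i` for all `i` and `a_i < b_i` for some `i`. Here `I` is a set of
  indices at which the inequality is strict, and equality holds at all the others. -/
  | mul (a b : List (Term ar V)) (as : Fin b.length → List (Term ar V))
      (I : Set (Fin b.length)) :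
      2 ≤ b.length → a.Perm (List.ofFn as).flatten → I.Nonempty →
      (∀ i ∈ I, PopLt (as i) [b.get i]) → (∀ i ∉ I, SameSeq (as i) [b.get i]) → PopLt a b
  /-- The relation does not distinguish lists that denote the same sequence. -/
  | congr (a a' b b' : List (Term ar V)) :
      SameSeq a a' → SameSeq b b' → PopLt a b → PopLt a' b'

/-- The one-step rewrite relation of a set `R` of rules `(l, r)`: closure under substitutions and
contexts. -/
inductive Step (R : Set (Term ar V × Term ar V)) : Term ar V → Term ar V → Prop
  | rule (l r : Term ar V) (θ : V → Term ar V) : (l, r) ∈ R → Step R (l.subst θ) (r.subst θ)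
  | ctx (f : Sym F) (ts : Fin (f.arity ar) → Term ar V) (i : Fin (f.arity ar))
      (u : Term ar V) :
      Step R (ts i) u → Step R (Term.app f ts) (Term.app f (Function.update ts i u))

/-- The lengths `n` of the derivations `t = t_0 → t_1 → ⋯ → t_n` consisting of ground terms. -/
def derivationLengths (R : Set (Term ar V × Term ar V)) (t : Term ar V) : Set ℕ :=
  {n | ∃ d : Fin (n + 1) → Term ar V, (∀ i, (d i).IsGround) ∧ d 0 = t ∧
    ∀ i : Fin n, Step R (d i.castSucc) (d i.succ)}

end POP

/-! Terms are interpreted by natural numbers so that every rewrite step lowers the value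
(`Step.interp_lt`), while the value of f on numerals is polynomial in their lengths; this value
bounds the derivation length. The symbols S_0, S_1 add 1, so that a numeral has its binary length as
value. Any other symbol of the finite set `U` of relevant symbols applies a polynomial, depending
only on its rank in the precedence, to a code of its list of argument values.

The order compares argument sequences essentially as multisets, and the code must respect this and
yet be polynomial in the largest argument. Infinitely many multisets lie below {1}, but among those
of cardinality K, the maximal arity, only (N+1)^K at most have all entries bounded by N. So
multisets are padded with zeros to cardinality K, and `rank` counts the Dershowitz–Manna smaller
ones of that cardinality.

If s ⊏ f(t_1, …, t_n), then s consists of at most depth(s) nested layers of symbols of lower rank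
over terms bounded by the arguments. Right-hand sides have bounded depth, so it suffices that the
polynomial of rank r+1 dominates a fixed number D of iterations of the bound for rank r
(`SqLt.interp_lt`); this stays polynomial. `PopLt.interp_lt` combines both ideas. -/

namespace POP

/-! ### Replacement of elements of multisets by smaller ones -/

/-- `A` arises from `B` by replacing some elements of `B` by smaller ones. -/
def DomLE (A B : Multiset ℕ) : Prop :=
  ∃ X Y Z, A = X + Y ∧ B = X + Z ∧ ∀ y ∈ Y, ∃ z ∈ Z, y < z

/-- `A` arises from `B` by replacing some elements of `B`, one of them positive, by smaller ones. -/
def DomLT (A B : Multiset ℕ) : Prop :=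
  ∃ X Y Z, A = X + Y ∧ B = X + Z ∧ (∃ z ∈ Z, 0 < z) ∧ ∀ y ∈ Y, ∃ z ∈ Z, y < z

theorem DomLE.refl (A : Multiset ℕ) : DomLE A A := ⟨A, 0, 0, by simp, by simp, by simp⟩

theorem DomLE.zero (A : Multiset ℕ) : DomLE 0 A := ⟨0, 0, A, by simp, by simp, by simp⟩

theorem DomLT.le {A B : Multiset ℕ} (h : DomLT A B) : DomLE A B := by
  obtain ⟨X, Y, Z, hA, hB, -, h⟩ := h
  exact ⟨X, Y, Z, hA, hB, h⟩

theorem DomLE.add {A B A' B' : Multiset ℕ} (h : DomLE A B) (h' : DomLE A' B') :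
    DomLE (A + A') (B + B') := by
  obtain ⟨X, Y, Z, rfl, rfl, h⟩ := h
  obtain ⟨X', Y', Z', rfl, rfl, h'⟩ := h'
  refine ⟨X + X', Y + Y', Z + Z', by abel, by abel, ?_⟩
  simp only [Multiset.mem_add]
  rintro y (hy | hy)
  · obtain ⟨z, hz, hyz⟩ := h y hy
    exact ⟨z, Or.inl hz, hyz⟩
  · obtain ⟨z, hz, hyz⟩ := h' y hy
    exact ⟨z, Or.inr hz, hyz⟩

theorem DomLT.add_le {A B A' B' : Multiset ℕ} (h : DomLT A B) (h' : DomLE A' B') :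
    DomLT (A + A') (B + B') := by
  obtain ⟨X, Y, Z, rfl, rfl, ⟨z₀, hz₀, hpos⟩, h⟩ := h
  obtain ⟨X', Y', Z', rfl, rfl, h'⟩ := h'
  refine ⟨X + X', Y + Y', Z + Z', by abel, by abel,
    ⟨z₀, Multiset.mem_add.2 (Or.inl hz₀), hpos⟩, ?_⟩
  simp only [Multiset.mem_add]
  rintro y (hy | hy)
  · obtain ⟨z, hz, hyz⟩ := h y hy
    exact ⟨z, Or.inl hz, hyz⟩
  · obtain ⟨z, hz, hyz⟩ := h' y hy
    exact ⟨z, Or.inr hz, hyz⟩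

theorem DomLE.sum {ι : Type*} (s : Finset ι) (A B : ι → Multiset ℕ)
    (h : ∀ i ∈ s, DomLE (A i) (B i)) : DomLE (∑ i ∈ s, A i) (∑ i ∈ s, B i) := by
  classical
  induction s using Finset.induction_on with
  | empty => exact DomLE.refl 0
  | insert i s hi ih =>
    rw [Finset.sum_insert hi, Finset.sum_insert hi]
    exact (h i (Finset.mem_insert_self i s)).add
      (ih fun j hj => h j (Finset.mem_insert_of_mem hj))

theorem DomLT.sum {ι : Type*} (s : Finset ι) (A B : ι → Multiset ℕ)
    (h : ∀ i ∈ s, DomLE (A i) (B i)) (j : ι) (hj : j ∈ s) (hlt : DomLT (A j) (B j)) :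
    DomLT (∑ i ∈ s, A i) (∑ i ∈ s, B i) := by
  classical
  rw [← Finset.add_sum_erase s A hj, ← Finset.add_sum_erase s B hj]
  exact hlt.add_le (DomLE.sum _ A B fun i hi => h i (Finset.mem_of_mem_erase hi))

theorem DomLT.singleton {A : Multiset ℕ} {n : ℕ} (hn : 0 < n) (h : ∀ x ∈ A, x < n) :
    DomLT A {n} :=
  ⟨0, A, {n}, by simp, by simp, ⟨n, by simp, hn⟩, fun y hy => ⟨n, by simp, h y hy⟩⟩

/-! ### Ranks of padded multisets and codes of lists -/

/-- The multiset `A` filled up with zeros to cardinality `K`. -/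
def pad (K : ℕ) (A : Multiset ℕ) : Multiset ℕ :=
  A + Multiset.replicate (K - A.card) 0

theorem card_pad {K : ℕ} {A : Multiset ℕ} (h : A.card ≤ K) : (pad K A).card = K := by
  simp only [pad, Multiset.card_add, Multiset.card_replicate]
  omega

theorem pad_zero_singleton {K : ℕ} (hK : 1 ≤ K) : pad K {0} = pad K 0 := by
  obtain ⟨k, rfl⟩ := Nat.exists_eq_add_of_le hK
  simp [pad, Multiset.replicate_add]

/-- Padding can add zeros on either side. Surplus zeros on the right count as removed elements;
surplus zeros on the left lie below the positive replaced element, which is why `DomLT` demands one.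
-/
theorem DomLT.pad_lt {K : ℕ} {A B : Multiset ℕ} (h : DomLT A B) (hB : B.card ≤ K) :
    (pad K A).IsDershowitzMannaLT (pad K B) := by
  obtain ⟨X, Y, Z, rfl, rfl, ⟨z₀, hz₀, hpos⟩, h⟩ := h
  simp only [pad]
  rcases le_total (K - (X + Y).card) (K - (X + Z).card) with hle | hle
  · obtain ⟨d, hd⟩ := Nat.exists_eq_add_of_le hle
    rw [hd, Multiset.replicate_add]
    generalize K - (X + Y).card = q
    refine ⟨X + Multiset.replicate q 0, Y, Z + Multiset.replicate d 0, ?_, by abel, by abel, ?_⟩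
    · intro h0
      have : z₀ ∈ Z + Multiset.replicate d 0 := Multiset.mem_add.2 (Or.inl hz₀)
      rw [h0] at this
      simp at this
    · intro y hy
      obtain ⟨z, hz, hyz⟩ := h y hy
      exact ⟨z, Multiset.mem_add.2 (Or.inl hz), hyz⟩
  · obtain ⟨d, hd⟩ := Nat.exists_eq_add_of_le hle
    rw [hd, Multiset.replicate_add]
    generalize K - (X + Z).card = q
    refine ⟨X + Multiset.replicate q 0, Y + Multiset.replicate d 0, Z, ?_, by abel, by abel, ?_⟩
    · rintro rfl
      simp at hz₀
    · intro y hy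
      rcases Multiset.mem_add.1 hy with hy | hy
      · exact h y hy
      · rw [Multiset.eq_of_mem_replicate hy]
        exact ⟨z₀, hz₀, hpos⟩

/-- The multisets of cardinality `K` below the multiset `A`, filled up with zeros. -/
def below (K : ℕ) (A : Multiset ℕ) : Set (Multiset ℕ) :=
  {C | C.card = K ∧ C.IsDershowitzMannaLT (pad K A)}

/-- The rank of `A` among the multisets of cardinality at most `K`. -/
noncomputable def rank (K : ℕ) (A : Multiset ℕ) : ℕ := (below K A).ncard

theorem below_subset (K N : ℕ) (A : Multiset ℕ) (hA : ∀ x ∈ A, x ≤ N) :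
    below K A ⊆ (fun φ : Fin K → Fin (N + 1) =>
      ((List.ofFn fun i => (φ i : ℕ)) : Multiset ℕ)) '' Set.univ := by
  rintro C ⟨hcard, X, Y, Z, -, rfl, hZ, h⟩
  have hpad : ∀ x ∈ pad K A, x ≤ N := by
    intro x hx
    rcases Multiset.mem_add.1 hx with hx | hx
    · exact hA x hx
    · rw [Multiset.eq_of_mem_replicate hx]
      exact Nat.zero_le N
  have hC : ∀ x ∈ X + Y, x ≤ N := by
    intro x hx
    rcases Multiset.mem_add.1 hx with hx | hx
    · exact hpad x (by rw [hZ]; exact Multiset.mem_add.2 (Or.inl hx))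
    · obtain ⟨z, hz, hxz⟩ := h x hx
      exact hxz.le.trans (hpad z (by rw [hZ]; exact Multiset.mem_add.2 (Or.inr hz)))
  generalize X + Y = C at hcard hC
  induction C using Quotient.inductionOn with
  | _ l =>
    simp only [Multiset.quot_mk_to_coe, Multiset.coe_card, Multiset.mem_coe] at hcard hC
    subst hcard
    refine ⟨fun i => ⟨l.get i, Nat.lt_succ_of_le (hC _ (List.get_mem l i))⟩, trivial, ?_⟩
    simp

theorem below_finite (K : ℕ) (A : Multiset ℕ) : (below K A).Finite :=
  (Set.finite_univ.image _).subset
    (below_subset K A.sum A fun _ hx => Multiset.single_le_sum (by simp) _ hx)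

theorem rank_le {K N : ℕ} {A : Multiset ℕ} (hA : ∀ x ∈ A, x ≤ N) : rank K A ≤ (N + 1) ^ K := by
  refine (Set.ncard_le_ncard (below_subset K N A hA) (Set.finite_univ.image _)).trans ?_
  refine (Set.ncard_image_le Set.finite_univ).trans ?_
  simp [Set.ncard_univ]

/-- By transitivity the set below `A` is contained in the set below `B`; the inclusion is strict
since `pad K A` itself lies only in the latter. -/
theorem rank_lt {K : ℕ} {A B : Multiset ℕ} (h : DomLT A B) (hA : A.card ≤ K) (hB : B.card ≤ K) :
    rank K A < rank K B := by
  have hlt := h.pad_lt hB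
  refine Set.ncard_lt_ncard ?_ (below_finite K B)
  refine ⟨fun C hC => ⟨hC.1, hC.2.trans hlt⟩, fun hsub => ?_⟩
  exact (Multiset.wellFounded_isDershowitzMannaLT (α := ℕ)).irrefl.irrefl _
    (hsub ⟨card_pad hA, hlt⟩).2

theorem rank_zero_singleton {K : ℕ} (hK : 1 ≤ K) : rank K {0} = rank K 0 := by
  rw [rank, rank, below, below, pad_zero_singleton hK]

theorem rank_le_add {K : ℕ} {A B : Multiset ℕ} (h : (A + B).card ≤ K) :
    rank K A ≤ rank K (A + B) := by
  have hA : A.card ≤ K := (Multiset.card_le_card (Multiset.le_add_right A B)).trans h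
  by_cases hpos : ∃ z ∈ B, 0 < z
  · exact (rank_lt ⟨A, 0, B, by simp, rfl, hpos, by simp⟩ hA h).le
  · have hB : B = Multiset.replicate B.card 0 :=
      Multiset.eq_replicate_card.2 fun z hz => by
        by_contra h0
        exact hpos ⟨z, hz, Nat.pos_of_ne_zero h0⟩
    -- When `B` consists of zeros, the padding absorbs it.
    have hpad : pad K (A + B) = pad K A := by
      rw [Multiset.card_add] at h
      rw [pad, pad, Multiset.card_add]
      nth_rewrite 1 [hB]
      rw [add_assoc, ← Multiset.replicate_add]
      congr 2
      omega
    rw [rank, rank, below, below, hpad]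

theorem rank_singleton_le {K x y : ℕ} {B : Multiset ℕ} (hy : y ∈ B) (hxy : x ≤ y)
    (hB : B.card ≤ K) : rank K {x} ≤ rank K B := by
  obtain ⟨B, rfl⟩ := Multiset.exists_cons_of_mem hy
  have hK : 1 ≤ K := by
    rw [Multiset.card_cons] at hB
    omega
  refine le_trans ?_ (rank_le_add (A := {y}) (B := B) hB)
  rcases hxy.lt_or_eq with hlt | rfl
  · exact (rank_lt (DomLT.singleton (Nat.zero_lt_of_lt hlt) (by simpa using hlt))
      (by simpa using hK) (by simpa using hK)).le
  · exact le_rfl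

theorem le_rank {K n : ℕ} (hK : 1 ≤ K) : n ≤ rank K {n} := by
  induction n with
  | zero => exact Nat.zero_le _
  | succ n ih =>
    exact Nat.succ_le_of_lt (ih.trans_lt (rank_lt
      (DomLT.singleton n.succ_pos (by simp)) (by simpa using hK) (by simpa using hK)))

/-- The code of a sequence of numbers: its rank as a multiset, and whether it has at least two
members. -/
noncomputable def code (K : ℕ) (l : List ℕ) : ℕ :=
  2 * rank K l + if 2 ≤ l.length then 1 else 0

theorem code_lt {K : ℕ} {a b : List ℕ} (h : DomLT (a : Multiset ℕ) b) (ha : a.length ≤ K)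
    (hb : b.length ≤ K) : code K a < code K b := by
  have := rank_lt h (by simpa using ha) (by simpa using hb)
  unfold code
  split_ifs <;> omega

/-- If all other members of `b` are 0, the ranks may coincide; the length bit of the code then
decides. The factor 2 keeps this bit from outweighing a difference in rank. -/
theorem code_singleton_lt {K x y : ℕ} {b : List ℕ} (hy : y ∈ b) (hxy : x ≤ y) (h2 : 2 ≤ b.length)
    (hb : b.length ≤ K) : code K [x] < code K b := by
  have := rank_singleton_le (K := K) (B := b) (by simpa using hy) hxy (by simpa using hb)
  rw [code, code, if_pos h2, if_neg (by simp)]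
  simp only [Multiset.coe_singleton]
  omega

theorem code_zero_singleton {K : ℕ} (hK : 1 ≤ K) : code K [0] = code K [] := by
  have := rank_zero_singleton hK
  simpa [code] using this

theorem code_le {K N : ℕ} {l : List ℕ} (h : ∀ x ∈ l, x ≤ N) : code K l ≤ 2 * (N + 1) ^ K + 1 := by
  have := rank_le (K := K) (A := l) (by simpa using h)
  unfold code
  split_ifs <;> omega

theorem le_code {K x : ℕ} {l : List ℕ} (hx : x ∈ l) (hl : l.length ≤ K) : x ≤ code K l := by
  have hK : 1 ≤ K := (List.length_pos_of_mem hx).trans_le hl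
  have h1 := le_rank (n := x) hK
  have h2 := rank_singleton_le (K := K) (B := l) (by simpa using hx) le_rfl (by simpa using hl)
  unfold code
  omega

/-! ### The polynomials attached to the ranks -/

open Polynomial

theorem eval_monotone (p : ℕ[X]) : Monotone fun x : ℕ => p.eval x := by
  intro x y hxy
  induction p using Polynomial.induction_on' with
  | add p q hp hq => simpa using add_le_add hp hq
  | monomial n a => simpa using Nat.mul_le_mul_left a (Nat.pow_le_pow_left hxy n)

/-- The bound for `f(x₁, …, xₙ)` in terms of `max xᵢ` that belongs to the interpretation `p`
of `f`. -/
noncomputable def compCode (K : ℕ) (p : ℕ[X]) : ℕ[X] :=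
  p.comp (2 * (X + 1) ^ K + 1)

/-- The interpretation of the symbols of rank `r`. -/
noncomputable def rankPoly (K D : ℕ) : ℕ → ℕ[X]
  | 0 => X + 1
  | r + 1 => (compCode K (rankPoly K D r)).comp^[D] X + X + 1

/-- The bound for `f(x₁, …, xₙ)` in terms of `max xᵢ`, if `f` has rank `r`. -/
noncomputable def rankBound (K D r N : ℕ) : ℕ := (compCode K (rankPoly K D r)).eval N

theorem rankBound_eq (K D r N : ℕ) :
    rankBound K D r N = (rankPoly K D r).eval (2 * (N + 1) ^ K + 1) := by
  simp [rankBound, compCode]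

theorem rankPoly_succ_eval (K D r x : ℕ) :
    (rankPoly K D (r + 1)).eval x = (rankBound K D r)^[D] x + x + 1 := by
  have (n : ℕ) : ((compCode K (rankPoly K D r)).comp^[n] X).eval x = (rankBound K D r)^[n] x := by
    rw [Polynomial.iterate_comp_eval, Polynomial.eval_X]
    rfl
  simp [rankPoly, this]

theorem lt_rankPoly_eval (K D r x : ℕ) : x < (rankPoly K D r).eval x := by
  cases r with
  | zero => simp [rankPoly]
  | succ r => rw [rankPoly_succ_eval]; omega

theorem rankBound_mono (K D r : ℕ) : Monotone (rankBound K D r) :=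
  eval_monotone (compCode K (rankPoly K D r))

theorem rankPoly_eval_strictMono (K D r : ℕ) :
    StrictMono fun x : ℕ => (rankPoly K D r).eval x := by
  cases r with
  | zero => intro x y h; simpa [rankPoly] using h
  | succ r =>
    intro x y h
    simp only [rankPoly_succ_eval]
    have := (rankBound_mono K D r).iterate D h.le
    omega

theorem lt_rankBound {K : ℕ} (hK : 1 ≤ K) (D r N : ℕ) : N < rankBound K D r N := by
  rw [rankBound_eq]
  refine lt_trans ?_ (lt_rankPoly_eval K D r _)
  have := Nat.pow_le_pow_right (Nat.succ_pos N) hK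
  rw [Nat.succ_eq_add_one, pow_one] at this
  omega

theorem rankBound_iterate_le {K : ℕ} (hK : 1 ≤ K) {D r d d' N : ℕ} (h : d ≤ d') :
    (rankBound K D r)^[d] N ≤ (rankBound K D r)^[d'] N :=
  Function.monotone_iterate_of_id_le (fun x => (lt_rankBound hK D r x).le) h N

/-- The polynomial of rank r+1 contains `D` iterations of the rank r bound, so one iteration already
suffices; this needs `D` positive. -/
theorem rankPoly_eval_le_succ {K D : ℕ} (hK : 1 ≤ K) (hD : 1 ≤ D) (r x : ℕ) :
    (rankPoly K D r).eval x ≤ (rankPoly K D (r + 1)).eval x := by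
  rw [rankPoly_succ_eval]
  have h1 := rankBound_iterate_le hK (D := D) (r := r) (N := x) hD
  have h2 : (rankPoly K D r).eval x ≤ rankBound K D r x := by
    rw [rankBound_eq]
    refine eval_monotone _ ?_
    have := Nat.pow_le_pow_right (Nat.succ_pos x) hK
    rw [Nat.succ_eq_add_one, pow_one] at this
    omega
  rw [Function.iterate_one] at h1
  omega

theorem rankBound_mono_rank {K D : ℕ} (hK : 1 ≤ K) (hD : 1 ≤ D) {r r' : ℕ} (h : r ≤ r') (x : ℕ) :
    rankBound K D r x ≤ rankBound K D r' x := by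
  rw [rankBound_eq, rankBound_eq]
  exact monotone_nat_of_le_succ (f := fun r => (rankPoly K D r).eval (2 * (x + 1) ^ K + 1))
    (fun r => rankPoly_eval_le_succ hK hD r _) h

theorem coe_ofFn {α : Type*} {n : ℕ} (u : Fin n → α) :
    (List.ofFn u : Multiset α) = ∑ i, {u i} := by
  induction n with
  | zero => rfl
  | succ n ih => rw [List.ofFn_succ, Fin.sum_univ_succ, ← ih]; rfl

theorem coe_flatten_ofFn {α : Type*} {n : ℕ} (u : Fin n → List α) :
    ((List.ofFn u).flatten : Multiset α) = ∑ i, (u i : Multiset α) := by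
  induction n with
  | zero => rfl
  | succ n ih => rw [List.ofFn_succ, Fin.sum_univ_succ, ← ih]; rfl

/-! ### The interpretation of terms and its strict monotonicity -/

section Interpretation

variable {F : Type*} {ar : F → ℕ} {V : Type*}

/-- The depth of a term, counting symbols. -/
def Term.depth : Term ar V → ℕ
  | .var _ => 0
  | .zero => 0
  | .app _ ts => (Finset.univ.sup fun i => (ts i).depth) + 1

theorem Term.depth_lt (f : Sym F) (ts : Fin (f.arity ar) → Term ar V) (i : Fin (f.arity ar)) :
    (ts i).depth < (Term.app f ts).depth :=
  Nat.lt_succ_of_le (Finset.le_sup (f := fun i => (ts i).depth) (Finset.mem_univ i))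

/-- All symbols of the term are in `U`. -/
def Term.Over (U : Finset (Sym F)) : Term ar V → Prop
  | .var _ => True
  | .zero => True
  | .app f ts => f ∈ U ∧ ∀ i, (ts i).Over U

variable [Preorder (Sym F)]

open Classical in
/-- The number of symbols of `U` below `f`. -/
noncomputable def symRank (U : Finset (Sym F)) (f : Sym F) : ℕ := (U.filter (· < f)).card

theorem symRank_mono {U : Finset (Sym F)} {f g : Sym F} (h : f ≤ g) : symRank U f ≤ symRank U g := by
  classical
  exact Finset.card_le_card (Finset.monotone_filter_right U fun _ _ hx => lt_of_lt_of_le hx h)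

theorem symRank_lt {U : Finset (Sym F)} {f g : Sym F} (hf : f ∈ U) (h : f < g) :
    symRank U f < symRank U g := by
  classical
  refine Finset.card_lt_card ⟨Finset.monotone_filter_right U fun _ _ hx => lt_trans hx h, ?_⟩
  intro hsub
  exact lt_irrefl f (Finset.mem_filter.1 (hsub (Finset.mem_filter.2 ⟨hf, h⟩))).2

open Classical in
/-- The interpretation of a symbol. -/
noncomputable def symInterp (U : Finset (Sym F)) (K D : ℕ) :
    (f : Sym F) → (Fin (f.arity ar) → ℕ) → ℕ
  | .succ _, w => ∑ j, w j + 1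
  | .fn f, w => if Sym.fn f ∈ U then (rankPoly K D (symRank U (Sym.fn f))).eval (code K (List.ofFn w))
      else ∑ j, w j + 1

/-- The interpretation of a term for given values of the variables. -/
noncomputable def Term.interp (U : Finset (Sym F)) (K D : ℕ) (v : V → ℕ) : Term ar V → ℕ
  | .var x => v x
  | .zero => 0
  | .app f ts => symInterp U K D f fun i => (ts i).interp U K D v

theorem Term.interp_subst (U : Finset (Sym F)) (K D : ℕ) (v : V → ℕ) (θ : V → Term ar V)
    (t : Term ar V) :
    (t.subst θ).interp U K D v = t.interp U K D fun x => (θ x).interp U K D v := by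
  induction t with
  | var x => rfl
  | zero => rfl
  | app f ts ih =>
    simp only [Term.subst, Term.interp]
    congr 1
    exact funext ih

theorem symInterp_le {U : Finset (Sym F)} {K D : ℕ} (hK : 1 ≤ K) {f : Sym F} (hf : f ∈ U)
    {w : Fin (f.arity ar) → ℕ} {N : ℕ} (hw : ∀ i, w i ≤ N) :
    symInterp U K D f w ≤ rankBound K D (symRank U f) N := by
  cases f with
  | succ i =>
    refine le_trans ?_ (Nat.succ_le_of_lt (lt_rankBound hK D _ N))
    exact Nat.succ_le_succ ((Fin.sum_univ_one (fun j : Fin 1 => w j)).trans_le (hw (0 : Fin 1)))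
  | fn f =>
    rw [symInterp, if_pos hf, rankBound_eq]
    refine eval_monotone _ (code_le ?_)
    rintro x hx
    obtain ⟨i, rfl⟩ := (List.mem_ofFn' _ _).1 hx
    exact hw i

/-- Needed for rewriting in contexts. Contexts may use symbols outside `U`, hence their default
interpretation as sum plus one. -/
theorem symInterp_update_lt {U : Finset (Sym F)} {K D : ℕ} (hU : ∀ f ∈ U, f.arity ar ≤ K)
    (f : Sym F) (w : Fin (f.arity ar) → ℕ) (i : Fin (f.arity ar)) {n : ℕ} (hn : n < w i) :
    symInterp U K D f (Function.update w i n) < symInterp U K D f w := by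
  have hsum : ∑ j, Function.update w i n j < ∑ j, w j := by
    refine Finset.sum_lt_sum (fun j _ => ?_) ⟨i, Finset.mem_univ i, by simpa using hn⟩
    by_cases h : j = i
    · subst h; simpa using hn.le
    · simp [h]
  cases f with
  | succ b => exact Nat.succ_lt_succ hsum
  | fn f =>
    by_cases hf : Sym.fn f ∈ U
    · rw [symInterp, if_pos hf, symInterp, if_pos hf]
      refine rankPoly_eval_strictMono K D _ (code_lt ?_ ?_ ?_)
      · rw [coe_ofFn, coe_ofFn]
        refine DomLT.sum _ _ _ (fun j _ => ?_) i (Finset.mem_univ i) ?_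
        · by_cases h : j = i
          · subst h
            simpa using (DomLT.singleton (A := {n}) (Nat.zero_lt_of_lt hn) (by simpa using hn)).le
          · simpa [h] using DomLE.refl _
        · simpa using DomLT.singleton (A := {n}) (Nat.zero_lt_of_lt hn) (by simpa using hn)
      · simpa using hU _ hf
      · simpa using hU _ hf
    · rw [symInterp, if_neg hf, symInterp, if_neg hf]
      exact Nat.succ_lt_succ hsum

end Interpretation

/-! ### Both orders decrease the interpretation -/

section Orders

variable {F : Type*} {ar : F → ℕ} {V : Type*} [Preorder (Sym F)]
  {U : Finset (Sym F)} {K D : ℕ} {v : V → ℕ}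

theorem Term.interp_succ (i : Bool) (ts : Fin ((Sym.succ i : Sym F).arity ar) → Term ar V) :
    (Term.app (.succ i) ts).interp U K D v = (ts (0 : Fin 1)).interp U K D v + 1 :=
  congrArg (· + 1) (Fin.sum_univ_one fun j : Fin 1 => (ts j).interp U K D v)

theorem Term.interp_fn {f : F} (hf : Sym.fn f ∈ U)
    (ts : Fin ((Sym.fn f).arity ar) → Term ar V) :
    (Term.app (.fn f) ts).interp U K D v =
      (rankPoly K D (symRank U (Sym.fn f))).eval
        (code K ((List.ofFn ts).map (Term.interp U K D v))) := by
  rw [Term.interp, symInterp, if_pos hf, List.map_ofFn]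
  rfl

/-- The maximum of the interpretations of some terms. -/
noncomputable def maxInterp (U : Finset (Sym F)) (K D : ℕ) (v : V → ℕ) {n : ℕ}
    (ts : Fin n → Term ar V) : ℕ :=
  Finset.univ.sup fun i => (ts i).interp U K D v

theorem le_maxInterp {n : ℕ} (ts : Fin n → Term ar V) (i : Fin n) :
    (ts i).interp U K D v ≤ maxInterp U K D v ts :=
  Finset.le_sup (f := fun i => (ts i).interp U K D v) (Finset.mem_univ i)

/-- The code of the arguments is at least their maximum, and the polynomial of rank r+1 exceeds `D`
iterations of the rank r bound. -/
theorem iterate_lt_interp_fn (hU : ∀ f ∈ U, f.arity ar ≤ K) (hK : 1 ≤ K) {f : F}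
    (hf : Sym.fn f ∈ U) (ts : Fin ((Sym.fn f).arity ar) → Term ar V) {d r : ℕ} (hd : d ≤ D)
    (hr : symRank U (Sym.fn f) = r + 1) :
    (rankBound K D r)^[d] (maxInterp U K D v ts) < (Term.app (.fn f) ts).interp U K D v := by
  rw [Term.interp_fn hf, hr, rankPoly_succ_eval]
  have hmax : maxInterp U K D v ts ≤ code K ((List.ofFn ts).map (Term.interp U K D v)) := by
    refine Finset.sup_le fun i _ => le_code ?_ (by simpa using hU _ hf)
    exact List.mem_map.2 ⟨ts i, (List.mem_ofFn' _ _).2 ⟨i, rfl⟩, rfl⟩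
  have h1 := (rankBound_mono K D r).iterate d hmax
  have h2 := rankBound_iterate_le hK (D := D) (r := r)
    (N := code K ((List.ofFn ts).map (Term.interp U K D v))) hd
  omega

theorem Term.interp_arg_lt (hU : ∀ f ∈ U, f.arity ar ≤ K) {f : Sym F} (hf : f ∈ U)
    (ts : Fin (f.arity ar) → Term ar V) (j : Fin (f.arity ar)) :
    (ts j).interp U K D v < (Term.app f ts).interp U K D v := by
  cases f with
  | succ i =>
    rw [Term.interp_succ, Subsingleton.elim (α := Fin 1) j (0 : Fin 1)]
    exact Nat.lt_succ_self _
  | fn f =>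
    rw [Term.interp_fn hf]
    refine lt_of_le_of_lt (le_code ?_ (by simpa using hU _ hf)) (lt_rankPoly_eval K D _ _)
    exact List.mem_map.2 ⟨ts j, (List.mem_ofFn' _ _).2 ⟨j, rfl⟩, rfl⟩

theorem SqLt.interp_lt (hS01 : Sym.succ (F := F) false ≤ Sym.succ true)
    (hS10 : Sym.succ (F := F) true ≤ Sym.succ false)
    (hlow : ∀ (i : Bool) (f : F), Sym.succ i < Sym.fn f)
    (hU : ∀ f ∈ U, f.arity ar ≤ K) (hS : Sym.succ false ∈ U) (hK : 1 ≤ K) (hD : 1 ≤ D)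
    {s t : Term ar V} (h : SqLt s t) (hs : s.Over U) (hd : s.depth ≤ D) (ht : t.Over U) :
    s.interp U K D v < t.interp U K D v := by
  have hsucc (i j : Bool) : Sym.succ (F := F) i ≤ Sym.succ j := by
    cases i <;> cases j <;> first | exact le_rfl | assumption
  -- The induction needs a bound from the arguments of `t` alone, with one iteration per layer of
  -- `s`: knowing only that each argument of `s` is below `t` would not bound `s` by `t`.
  suffices hmain : s.interp U K D v < t.interp U K D v ∧
      ∀ (f : F) (ts : Fin ((Sym.fn f).arity ar) → Term ar V), t = Term.app (.fn f) ts →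
        ∀ r, symRank U (Sym.fn f) = r + 1 →
          s.interp U K D v ≤ (rankBound K D r)^[s.depth] (maxInterp U K D v ts) from hmain.1
  induction h with
  | arg f ts j =>
    refine ⟨Term.interp_arg_lt hU ht.1 ts j, ?_⟩
    rintro f' ts' h r -
    cases h
    exact (le_maxInterp ts' j).trans (rankBound_iterate_le hK (d := 0) (Nat.zero_le _))
  | sub f ts j s _ ih =>
    have hlt := (ih hs hd (ht.2 j)).1
    refine ⟨hlt.trans (Term.interp_arg_lt hU ht.1 ts j), ?_⟩
    rintro f' ts' h r -
    cases h
    exact (hlt.le.trans (le_maxInterp ts' j)).trans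
      (rankBound_iterate_le hK (d := 0) (Nat.zero_le _))
  | app f g ts ss hgf _ ih =>
    cases f with
    | succ i =>
      exfalso
      cases g with
      | succ j => exact (hsucc i j).not_gt hgf
      | fn g => exact lt_asymm hgf (hlow i g)
    | fn f =>
      have hle (r) (hr : symRank U (Sym.fn f) = r + 1) : (Term.app g ss).interp U K D v ≤
          (rankBound K D r)^[(Term.app g ss).depth] (maxInterp U K D v ts) := by
        have hgr : symRank U g ≤ r := by
          have := symRank_lt hs.1 hgf
          omega
        refine (symInterp_le hK hs.1 (N := (rankBound K D r)^[(Term.app g ss).depth - 1]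
          (maxInterp U K D v ts)) fun i => ?_).trans ?_
        · refine ((ih i (hs.2 i) ((Term.depth_lt g ss i).le.trans hd) ht).2 f ts rfl r hr).trans ?_
          exact rankBound_iterate_le hK (Nat.le_pred_of_lt (Term.depth_lt g ss i))
        · refine (rankBound_mono_rank hK hD hgr _).trans ?_
          rw [← Function.iterate_succ_apply' (rankBound K D r)]
          exact le_rfl
      -- S_0 belongs to `U` and lies below `f`, so the rank of `f` is positive.
      obtain ⟨r, hr⟩ := Nat.exists_eq_add_one_of_ne_zero
        (Nat.ne_of_gt (Nat.zero_lt_of_lt (symRank_lt hS (hlow false f))))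
      refine ⟨(hle r hr).trans_lt (iterate_lt_interp_fn hU hK ht.1 ts hd hr), ?_⟩
      intro f' ts' h r' hr'
      cases h
      exact hle r' hr'

/-- Against a single term the members of `a` are bounded one by one, so `a` may be arbitrarily long.
Codes compare only lists of length at most `K`, which covers the argument lists in the clause for
equivalent symbols. Positivity of the single term makes even an empty `a` strictly dominated. -/
theorem PopLt.interp_lt (hS01 : Sym.succ (F := F) false ≤ Sym.succ true)
    (hS10 : Sym.succ (F := F) true ≤ Sym.succ false)
    (hlow : ∀ (i : Bool) (f : F), Sym.succ i < Sym.fn f)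
    (hU : ∀ f ∈ U, f.arity ar ≤ K) (hS : Sym.succ false ∈ U) (hK : 1 ≤ K) (hD : 1 ≤ D)
    {a b : List (Term ar V)} (h : PopLt a b) (ha : ∀ s ∈ a, s.Over U ∧ s.depth ≤ D)
    (hb : ∀ t ∈ b, t.Over U) :
    b ≠ [] ∧ (∀ t, b = [t] → 0 < t.interp U K D v ∧
        ∀ s ∈ a, s.interp U K D v < t.interp U K D v) ∧
      (a.length ≤ K → b.length ≤ K →
        code K (a.map (Term.interp U K D v)) < code K (b.map (Term.interp U K D v))) := by
  have hsq {s t : Term ar V} (h : SqLt s t) (hs : s.Over U ∧ s.depth ≤ D) (ht : t.Over U) :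
      s.interp U K D v < t.interp U K D v :=
    h.interp_lt hS01 hS10 hlow hU hS hK hD hs.1 hs.2 ht
  have happ (f : Sym F) (ts : Fin (f.arity ar) → Term ar V) (hf : f ∈ U) :
      0 < (Term.app f ts).interp U K D v := by
    cases f with
    | succ i => rw [Term.interp_succ]; exact Nat.succ_pos _
    | fn f => rw [Term.interp_fn hf]; exact Nat.zero_lt_of_lt (lt_rankPoly_eval _ _ _ _)
  have hsingle {a : List (Term ar V)} {t : Term ar V} (h0 : 0 < t.interp U K D v)
      (h : ∀ s ∈ a, s.interp U K D v < t.interp U K D v) :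
      [t] ≠ [] ∧ (∀ t', [t] = [t'] → 0 < t'.interp U K D v ∧
        ∀ s ∈ a, s.interp U K D v < t'.interp U K D v) ∧
      (a.length ≤ K → [t].length ≤ K →
        code K (a.map (Term.interp U K D v)) < code K ([t].map (Term.interp U K D v))) := by
    refine ⟨by simp, ?_, fun h1 h2 => ?_⟩
    · rintro t' ht'
      cases ht'
      exact ⟨h0, h⟩
    · refine code_lt ?_ (by simpa using h1) (by simpa using h2)
      exact DomLT.singleton h0 (by simpa using h)
  induction h with
  | sq s t hst =>
    have := hsq hst (ha s (by simp)) (hb t (by simp))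
    exact hsingle (Nat.zero_lt_of_lt this) (by simpa using this)
  | arg f ts j =>
    have := hsq (SqLt.arg f ts j) (ha _ (by simp)) (hb _ (by simp))
    exact hsingle (Nat.zero_lt_of_lt this) (by simpa using this)
  | sub f ts j s _ ih =>
    have ht := hb _ (List.mem_singleton_self _)
    have h1 := ((ih ha (by simpa using ht.2 j)).2.1 _ rfl).2 s (by simp)
    refine hsingle (happ f ts ht.1) ?_
    rintro s' hs'
    cases List.mem_singleton.1 hs'
    exact h1.trans (Term.interp_arg_lt hU ht.1 ts j)
  | seqArg b t h2 htb =>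
    refine ⟨by rintro rfl; simp at h2, by rintro t' rfl; simp at h2, fun _ hbK => ?_⟩
    exact code_singleton_lt (List.mem_map.2 ⟨t, htb, rfl⟩) le_rfl (by simpa using h2)
      (by simpa using hbK)
  | seqSub b s t h2 htb _ ih =>
    have h1 := ((ih ha (by simpa using hb t htb)).2.1 _ rfl).2 s (by simp)
    refine ⟨by rintro rfl; simp at h2, by rintro t' rfl; simp at h2, fun _ hbK => ?_⟩
    exact code_singleton_lt (List.mem_map.2 ⟨t, htb, rfl⟩) h1.le (by simpa using h2)
      (by simpa using hbK)
  | nil f ts => exact hsingle (happ f ts (hb _ (List.mem_singleton_self _)).1) (by simp)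
  | seq f ts a i₀ hsqs _ ih =>
    have ht := hb _ (List.mem_singleton_self _)
    refine hsingle (happ f ts ht.1) fun s hs => ?_
    obtain ⟨i, rfl⟩ := List.get_of_mem hs
    by_cases hi : i = i₀
    · subst hi
      exact ((ih (by simpa using ha _ hs) hb).2.1 _ rfl).2 _ (by simp)
    · exact hsq (hsqs i hi) (ha _ hs) ht
  | mono f g ts ss hfg hgf _ ih =>
    have ht := hb _ (List.mem_singleton_self _)
    have hs := ha _ (List.mem_singleton_self _)
    have hss (s) (h : s ∈ List.ofFn ss) : s.Over U ∧ s.depth ≤ D := by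
      obtain ⟨i, rfl⟩ := (List.mem_ofFn' _ _).1 h
      exact ⟨hs.1.2 i, (Term.depth_lt g ss i).le.trans hs.2⟩
    have hts (t) (h : t ∈ List.ofFn ts) : t.Over U := by
      obtain ⟨i, rfl⟩ := (List.mem_ofFn' _ _).1 h
      exact ht.2 i
    have h1 := (ih hss hts).2
    refine hsingle (happ f ts ht.1) fun s' hs' => ?_
    cases List.mem_singleton.1 hs'
    -- Equivalent symbols are both successors or both in Σ', because S_0, S_1 lie strictly below Σ'.
    -- In the latter case their ranks, hence their polynomials, agree.
    cases f with
    | succ i =>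
      cases g with
      | succ j =>
        rw [Term.interp_succ, Term.interp_succ]
        exact Nat.succ_lt_succ ((h1.1 (ts (0 : Fin 1)) rfl).2 (ss (0 : Fin 1))
          ((List.mem_ofFn' _ _).2 ⟨(0 : Fin 1), rfl⟩))
      | fn g => exact absurd hgf (hlow i g).not_ge
    | fn f =>
      cases g with
      | succ j => exact absurd hfg (hlow j f).not_ge
      | fn g =>
        rw [Term.interp_fn hs.1.1, Term.interp_fn ht.1,
          (symRank_mono hgf).antisymm (symRank_mono hfg)]
        exact rankPoly_eval_strictMono K D _
          (h1.2 (by simpa using hU _ hs.1.1) (by simpa using hU _ ht.1))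
  | mul a b as I h2 hperm hI _ heq ih =>
    refine ⟨by rintro rfl; simp at h2, by rintro t' rfl; simp at h2, fun haK hbK => ?_⟩
    refine code_lt ?_ (by simpa using haK) (by simpa using hbK)
    have hA : ((a.map (Term.interp U K D v) : List ℕ) : Multiset ℕ) =
        ∑ i, (((as i).map (Term.interp U K D v) : List ℕ) : Multiset ℕ) := by
      rw [← coe_flatten_ofFn, Multiset.coe_eq_coe]
      refine (hperm.map _).trans (List.Perm.of_eq ?_)
      rw [List.map_flatten, List.map_ofFn]
      rfl
    have hB : ((b.map (Term.interp U K D v) : List ℕ) : Multiset ℕ) =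
        ∑ i, {(b.get i).interp U K D v} := by
      rw [← coe_ofFn]
      conv_lhs => rw [← List.ofFn_get b, List.map_ofFn]
      rfl
    have hlt (i) (hi : i ∈ I) : DomLT (((as i).map (Term.interp U K D v) : List ℕ) : Multiset ℕ)
        {(b.get i).interp U K D v} := by
      have := (ih i hi (fun s hs => ha s (hperm.symm.subset (List.mem_flatten.2
        ⟨as i, (List.mem_ofFn' _ _).2 ⟨i, rfl⟩, hs⟩)))
        (by simpa using hb _ (List.get_mem b i))).2.1 _ rfl
      exact DomLT.singleton this.1 (by simpa using this.2)
    rw [hA, hB]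
    obtain ⟨j, hj⟩ := hI
    refine DomLT.sum _ _ _ (fun i _ => ?_) j (Finset.mem_univ j) (hlt j hj)
    by_cases hi : i ∈ I
    · exact (hlt i hi).le
    -- Identical sequences may also be `[]` and `[zero]`; dropping a zero is a weak domination.
    · rcases heq i hi with h | ⟨h | h, h' | h'⟩
      · rw [h]; exact DomLE.refl _
      · rw [h]; exact DomLE.zero _
      · rw [h]; exact DomLE.zero _
      · simp at h'
      · rw [h, ← h']; exact DomLE.refl _
  | congr a a' b b' haa hbb _ ih =>
    have hzero : (Term.zero : Term ar V).Over U ∧ (Term.zero : Term ar V).depth ≤ D :=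
      ⟨trivial, Nat.zero_le _⟩
    have ha₀ : ∀ s ∈ a, s.Over U ∧ s.depth ≤ D := by
      rcases haa with rfl | ⟨rfl | rfl, -⟩
      · exact ha
      · simp
      · simpa using hzero
    have hb₀ : ∀ t ∈ b, t.Over U := by
      rcases hbb with rfl | ⟨rfl | rfl, -⟩
      · exact hb
      · simp
      · simpa using hzero.1
    obtain ⟨h1, h2, h3⟩ := ih ha₀ hb₀
    rcases hbb with rfl | ⟨rfl | rfl, -⟩
    · rcases haa with rfl | ⟨h, h'⟩
      · exact ⟨h1, h2, h3⟩
      · refine ⟨h1, fun t ht => ⟨(h2 t ht).1, fun s hs => ?_⟩, fun _ hbK => ?_⟩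
        · rcases h' with rfl | rfl
          · simp at hs
          · rw [List.mem_singleton.1 hs]
            exact (h2 t ht).1
        · have haK : a.length ≤ K := by
            rcases h with rfl | rfl
            · exact Nat.zero_le _
            · exact hK
          -- Padding identifies the empty sequence with the sequence of a single 0.
          have hz : code K [Term.interp U K D v (Term.zero : Term ar V)] = code K [] := code_zero_singleton hK
          refine lt_of_eq_of_lt ?_ (h3 haK hbK)
          rcases h with rfl | rfl <;> rcases h' with rfl | rfl <;> simp [hz]
    -- The larger side cannot denote the empty sequence: it is nonempty, and a single term there has
    -- positive value.
    · exact absurd rfl h1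
    · exact absurd (h2 _ rfl).1 (lt_irrefl 0)

end Orders

/-! ### Rewrite steps and derivation lengths -/

section Derivations

variable {F : Type*} {ar : F → ℕ} {V : Type*}

theorem Term.Over.mono {U U' : Finset (Sym F)} (h : U ⊆ U') {t : Term ar V} (ht : t.Over U) :
    t.Over U' := by
  induction t with
  | var x => trivial
  | zero => trivial
  | app f ts ih => exact ⟨h ht.1, fun i => ih i (ht.2 i)⟩

theorem Term.exists_over (t : Term ar V) : ∃ U : Finset (Sym F), t.Over U := by
  classical
  induction t with
  | var x => exact ⟨∅, trivial⟩
  | zero => exact ⟨∅, trivial⟩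
  | app f ts ih =>
    choose U hU using ih
    refine ⟨insert f (Finset.univ.biUnion U), Finset.mem_insert_self _ _, fun i => ?_⟩
    exact (hU i).mono ((Finset.subset_biUnion_of_mem U (Finset.mem_univ i)).trans
      (Finset.subset_insert _ _))

theorem exists_over_of_finite {T : Set (Term ar V)} (hT : T.Finite) :
    ∃ U : Finset (Sym F), ∀ t ∈ T, t.Over U := by
  classical
  choose U hU using Term.exists_over (ar := ar) (V := V)
  exact ⟨hT.toFinset.biUnion U, fun t ht => (hU t).mono
    (Finset.subset_biUnion_of_mem U (hT.mem_toFinset.2 ht))⟩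

theorem numeral_isGround (m : ℕ) : (numeral ar V m).IsGround := by
  induction m using Nat.binaryRec' with
  | zero => simp [numeral, Term.IsGround]
  | bit b n h ih =>
    rw [numeral, Nat.binaryRec_eq b n (Or.inr h)]
    exact fun _ => ih

theorem derivationLength_le {R : Set (Term ar V × Term ar V)} {μ : Term ar V → ℕ}
    (hμ : ∀ t u, Step R t u → μ u < μ t) {t : Term ar V} {n : ℕ}
    (hn : n ∈ derivationLengths R t) : n ≤ μ t := by
  obtain ⟨d, -, rfl, hd⟩ := hn
  have (i : Fin (n + 1)) : μ (d i) + i ≤ μ (d 0) := by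
    induction i using Fin.induction with
    | zero => simp
    | succ i ih =>
      have := hμ _ _ (hd i)
      simp only [Fin.val_castSucc, Fin.val_succ] at ih ⊢
      omega
  have := this (Fin.last n)
  rw [Fin.val_last] at this
  omega

variable [Preorder (Sym F)] {U : Finset (Sym F)} {K D : ℕ}

theorem interp_numeral (v : V → ℕ) (m : ℕ) : (numeral ar V m).interp U K D v = m.size := by
  induction m using Nat.binaryRec' with
  | zero => simp [numeral, Term.interp]
  | bit b n h ih =>
    rw [numeral, Nat.binaryRec_eq b n (Or.inr h), Term.interp_succ]
    rw [Nat.size_bit (Nat.bit_ne_zero_iff.2 h)]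
    exact congrArg (· + 1) ih

theorem Step.interp_lt {R : Set (Term ar V × Term ar V)} (hU : ∀ f ∈ U, f.arity ar ≤ K)
    (hR : ∀ (l r : Term ar V) (v : V → ℕ), (l, r) ∈ R → r.interp U K D v < l.interp U K D v)
    (v : V → ℕ) {t u : Term ar V} (h : Step R t u) : u.interp U K D v < t.interp U K D v := by
  induction h with
  | rule l r θ hlr =>
    rw [Term.interp_subst, Term.interp_subst]
    exact hR l r _ hlr
  | ctx f ts i u _ ih =>
    have := symInterp_update_lt (K := K) (D := D) hU f (fun j => (ts j).interp U K D v) i ih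
    rw [Term.interp, Term.interp]
    convert this using 2
    funext j
    by_cases hj : j = i
    · subst hj; simp
    · simp [hj]

end Derivations

end POP

/-! ### Choice of the constants and conclusion -/

theorem mainTheorem6 {F : Type*} (ar : F → ℕ) {V : Type*}
    [Preorder (POP.Sym F)] [WellFoundedLT (POP.Sym F)]
    (hS01 : POP.Sym.succ (F := F) false ≤ POP.Sym.succ true)
    (hS10 : POP.Sym.succ (F := F) true ≤ POP.Sym.succ false)
    (hlow : ∀ (i : Bool) (f : F), POP.Sym.succ i < POP.Sym.fn f)
    (R : Set (POP.Term ar V × POP.Term ar V)) (hfin : R.Finite)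
    (hR : ∀ l r : POP.Term ar V, (l, r) ∈ R → POP.PopLt [r] [l])
    (f : POP.Sym F) :
    ∃ p : Polynomial ℕ, Monotone (fun x : ℕ => p.eval x) ∧
      ∀ m : Fin (f.arity ar) → ℕ,
        ∃ L : ℕ,
          IsGreatest (POP.derivationLengths R
            (POP.Term.app f (fun i => POP.numeral ar V (m i)))) L ∧
          L ≤ p.eval (∑ i, Nat.size (m i)) := by
  classical
  obtain ⟨U₁, hU₁⟩ := POP.exists_over_of_finite (hfin.image Prod.fst)
  obtain ⟨U₂, hU₂⟩ := POP.exists_over_of_finite (hfin.image Prod.snd)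
  obtain ⟨D, hD⟩ := (hfin.image fun lr => lr.2.depth).bddAbove
  -- S_0 makes `K` and the ranks of the symbols of Σ' in `U` positive; `f` is included because the
  -- starting term need not use a symbol of the rules.
  let U : Finset (POP.Sym F) := {.succ false, f} ∪ (U₁ ∪ U₂)
  let K := U.sup fun g => g.arity ar
  have hU (g) (hg : g ∈ U) : g.arity ar ≤ K := Finset.le_sup (f := fun g => g.arity ar) hg
  have hS : POP.Sym.succ false ∈ U := by simp [U]
  have hf : f ∈ U := by simp [U]
  have hK : 1 ≤ K := hU _ hS
  have hUl : U₁ ⊆ U := Finset.subset_union_left.trans Finset.subset_union_right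
  have hUr : U₂ ⊆ U := Finset.subset_union_right.trans Finset.subset_union_right
  -- The depth bound is raised to `D + 1` because a positive number of iterations is required.
  have hrule (l r : POP.Term ar V) (v : V → ℕ) (h : (l, r) ∈ R) :
      r.interp U K (D + 1) v < l.interp U K (D + 1) v := by
    have hr : r.Over U ∧ r.depth ≤ D + 1 :=
      ⟨(hU₂ r ⟨_, h, rfl⟩).mono hUr, (hD ⟨_, h, rfl⟩).trans (Nat.le_succ D)⟩
    exact (((hR l r h).interp_lt hS01 hS10 hlow hU hS hK (Nat.succ_pos D) (by simpa using hr)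
      (by simpa using (hU₁ l ⟨_, h, rfl⟩).mono hUl)).2.1 l rfl).2 r (List.mem_singleton_self r)
  refine ⟨POP.compCode K (POP.rankPoly K (D + 1) (POP.symRank U f)), POP.eval_monotone _,
    fun m => ?_⟩
  set t := POP.Term.app f fun i => POP.numeral ar V (m i) with ht
  have hbound (n) (hn : n ∈ POP.derivationLengths R t) :
      n ≤ POP.rankBound K (D + 1) (POP.symRank U f) (∑ i, Nat.size (m i)) := by
    refine (POP.derivationLength_le (μ := POP.Term.interp U K (D + 1) fun _ => 0)
      (fun _ _ h => h.interp_lt hU hrule _) hn).trans (POP.symInterp_le hK hf fun i => ?_)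
    rw [POP.interp_numeral]
    exact Finset.single_le_sum (f := fun i => Nat.size (m i)) (fun _ _ => Nat.zero_le _)
      (Finset.mem_univ i)
  have hne : (POP.derivationLengths R t).Nonempty :=
    ⟨0, fun _ => t, fun _ i => POP.numeral_isGround (m i), rfl, fun i => i.elim0⟩
  have hgreatest := Nat.sSup_mem hne ⟨_, hbound⟩
  exact ⟨_, ⟨hgreatest, fun n hn => le_csSup ⟨_, hbound⟩ hn⟩, hbound _ hgreatest⟩
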